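/- Fix a first-order language and an infinite set of variables. An atom is $p(t_1,\dots,t_n)$ with $p$ a predicate symbol and $t_i$ terms; $\mathrm{rel}(A)$ is the predicate symbol of the atom $A$. Two atoms (clauses) are variants if each is an instance of the other; the extended Herbrand base $B^E$ is the set of atoms modulo the variant relation. A definite program $P$ is a finite set of clauses $H\leftarrow B_1,\dots,B_n$ ($n\ge 0$) with atoms $H,B_i$. A query is a finite sequence of atoms. An LD-derivation for $P$ and a query $Q_0$ is an SLD-derivation with the left-to-right selection rule: from $A,Q$ one passes to $(B_1,\dots,B_n,Q)\theta$, where $H\leftarrow B_1,\dots,B_n$ is a variant of a clause of $P$, having no variable in common with $Q_0$, the earlier input clauses and the earlier unifiers, and $\theta$ is a most general unifier of $A$ and $H$. An LD-tree for $P$ and $Q_0$ is a tree of LD-derivations starting from $Q_0$ in which every node has exactly one child for each clause of $P$ that is applicable to the leftmost atom, and no other children. $Q_0$ LD-terminates for $P$ if the LD-tree for $P$ and $Q_0$ (for every choice of the names of variables and of the unifiers) is finite. A computed answer substitution for a query is the composition of the unifiers of an LD-derivation from it that ends in the empty query, restricted to the variables of the query. For a set $S$ of atomic queries, $\mathrm{Call}(P,S)$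 is the set of all atoms $A$ such that a variant of $A$ is the selected atom in some LD-derivation for $P$ and some $Q\in S$. A predicate $p$ refers to $q$ in $P$ if some clause of $P$ has $p$ in its head and $q$ in its body; $\sqsupseteq$ is the reflexive transitive closure of this relation, and $p\simeq q$ ($p$, $q$ are mutually recursive) means $p\sqsupseteq q$ and $q\sqsupseteq p$. $P$ is term-acceptable with respect to $S$ if there is a well-founded order $>$ on $B^E$ (an irreflexive, asymmetric and transitive relation without infinite descending sequences) such that for every $A\in\mathrm{Call}(P,S)$, every variant $A'\leftarrow B_1,\dots,B_n$ of a clause of $P$ without variables in common with $A$, every most general unifier $\theta$ of $A$ and $A'$, every $i$ with $\mathrm{rel}(B_i)\simeq\mathrm{rel}(A)$, and every computed answer substitution $\sigma$ for $(B_1,\dots,B_{i-1})\theta$ (standardized apart: no variable introduced by $\sigma$ that does not occur in $(B_1,\dots,B_{i-1})\theta$ occurs in $B_i\theta$), $$A > B_i\theta\sigma ,$$ where atoms stand for their classes in $B^E$. **Theorem.** Let $P$ be a definite program and $S$ a set of atomic queries. Then $P$ is term-acceptable with respect to $S$ if and only if every query in $S$ LD-terminates for $P$. -/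

import Mathlib

universe u v w

namespace LogicProgram

variable {L : FirstOrder.Language.{u, v}} {V : Type w}

/-! ### Terms, atoms, substitutions

Terms are Mathlib's first-order terms over the language `L` with variables in `V`. -/

/-- An atom `p(t₁, …, tₙ)`. -/
structure Atom (L : FirstOrder.Language.{u, v}) (V : Type w) where
  arity : ℕ
  pred : L.Relations arity
  args : Fin arity → L.Term V

/-- A query (goal) is a finite sequence of atoms. -/
abbrev Query (L : FirstOrder.Language.{u, v}) (V : Type w) := List (Atom L V)

/-- A definite clause `head ← body`. -/
structure Clause (L : FirstOrder.Language.{u, v}) (V : Type w) where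
  head : Atom L V
  body : List (Atom L V)

/-- A substitution, given by the image of every variable. -/
abbrev Subst (L : FirstOrder.Language.{u, v}) (V : Type w) := V → L.Term V

open Classical in
/-- The variables occurring in a term. -/
def termVars (t : L.Term V) : Set V := {x | x ∈ t.varFinset}

/-- The predicate symbol (with its arity) of an atom, `rel(A)`. -/
def Atom.rel (A : Atom L V) : Σ n, L.Relations n := ⟨A.arity, A.pred⟩

/-- The variables occurring in an atom. -/
def Atom.vars (A : Atom L V) : Set V := {x | ∃ i, x ∈ termVars (A.args i)}

/-- The variables occurring in a query. -/
def Query.vars (Q : Query L V) : Set V := {x | ∃ A ∈ Q, x ∈ A.vars}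

/-- The variables occurring in a clause. -/
def Clause.vars (c : Clause L V) : Set V := c.head.vars ∪ Query.vars c.body

/-- Application of a substitution to an atom. -/
def Atom.subst (A : Atom L V) (σ : Subst L V) : Atom L V :=
  ⟨A.arity, A.pred, fun i => (A.args i).subst σ⟩

/-- Application of a substitution to a query. -/
def Query.subst (Q : Query L V) (σ : Subst L V) : Query L V := List.map (fun A => A.subst σ) Q

/-- Application of a substitution to a clause. -/
def Clause.subst (c : Clause L V) (σ : Subst L V) : Clause L V :=
  ⟨c.head.subst σ, Query.subst c.body σ⟩

/-- The composition `θη`: first `θ`, then `η`. -/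
def Subst.comp (θ η : Subst L V) : Subst L V := fun x => (θ x).subst η

/-- The domain of a substitution: the variables that it moves. -/
def Subst.dom (θ : Subst L V) : Set V := {x | θ x ≠ FirstOrder.Language.Term.var x}

/-- The variables of a substitution: those in its domain and those in the images of these. -/
def Subst.vars (θ : Subst L V) : Set V := θ.dom ∪ {y | ∃ x ∈ θ.dom, y ∈ termVars (θ x)}

open Classical in
/-- The restriction of a substitution to a set of variables. -/
noncomputable def Subst.restrict (θ : Subst L V) (X : Set V) : Subst L V :=
  fun x => if x ∈ X then θ x else FirstOrder.Language.Term.var x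

/-- `θ` is a most general unifier of `A` and `B`: it moves only finitely many variables, unifies
`A` and `B`, and every unifier factors through it. -/
def IsMGU (θ : Subst L V) (A B : Atom L V) : Prop :=
  θ.dom.Finite ∧ A.subst θ = B.subst θ ∧
    ∀ η : Subst L V, A.subst η = B.subst η → ∃ γ : Subst L V, η = θ.comp γ

/-- Two atoms are variants if each is an instance of the other. -/
def Atom.Variant (A B : Atom L V) : Prop :=
  (∃ σ : Subst L V, B = A.subst σ) ∧ ∃ τ : Subst L V, A = B.subst τ

/-- Two clauses are variants if each is an instance of the other. -/
def Clause.Variant (c d : Clause L V) : Prop :=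
  (∃ σ : Subst L V, d = c.subst σ) ∧ ∃ τ : Subst L V, c = d.subst τ

theorem term_subst_var (t : L.Term V) : t.subst (FirstOrder.Language.Term.var : Subst L V) = t := by
  induction t with
  | var x => rfl
  | func f ts ih => simp only [FirstOrder.Language.Term.subst]; congr 1; funext i; exact ih i

theorem term_subst_subst (t : L.Term V) (θ η : Subst L V) :
    (t.subst θ).subst η = t.subst (θ.comp η) := by
  induction t with
  | var x => rfl
  | func f ts ih => simp only [FirstOrder.Language.Term.subst]; congr 1; funext i; exact ih i

theorem Atom.subst_var (A : Atom L V) : A.subst (FirstOrder.Language.Term.var : Subst L V) = A := by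
  cases A; simp only [Atom.subst, term_subst_var]

theorem Atom.subst_subst (A : Atom L V) (θ η : Subst L V) :
    (A.subst θ).subst η = A.subst (θ.comp η) := by
  cases A; simp only [Atom.subst, term_subst_subst]

/-- The variant relation on atoms is an equivalence relation. -/
def variantSetoid (L : FirstOrder.Language.{u, v}) (V : Type w) : Setoid (Atom L V) where
  r := Atom.Variant
  iseqv :=
    { refl := fun A => ⟨⟨_, A.subst_var.symm⟩, ⟨_, A.subst_var.symm⟩⟩
      symm := fun h => ⟨h.2, h.1⟩
      trans := by
        rintro A B C ⟨⟨σ, rfl⟩, τ, hτ⟩ ⟨⟨σ', rfl⟩, τ', hτ'⟩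
        refine ⟨⟨σ.comp σ', A.subst_subst σ σ'⟩, τ'.comp τ, ?_⟩
        rw [← Atom.subst_subst, ← hτ', ← hτ] }

/-- The extended Herbrand base: atoms modulo the variant relation. -/
abbrev ExtHerbrandBase (L : FirstOrder.Language.{u, v}) (V : Type w) := Quotient (variantSetoid L V)

/-- The class of an atom in the extended Herbrand base. -/
def Atom.toBase (A : Atom L V) : ExtHerbrandBase L V := Quotient.mk (variantSetoid L V) A

/-! ### Dependencies between predicates -/

/-- `p` refers to `q` in `P`: some clause of `P` has `p` in its head and `q` in its body. -/
def RefersTo (P : Set (Clause L V)) (p q : Σ n, L.Relations n) : Prop :=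
  ∃ c ∈ P, c.head.rel = p ∧ ∃ B ∈ c.body, B.rel = q

/-- `p` depends on `q`: the reflexive transitive closure of "refers to". -/
def DependsOn (P : Set (Clause L V)) : (Σ n, L.Relations n) → (Σ n, L.Relations n) → Prop :=
  Relation.ReflTransGen (RefersTo P)

/-- `p` and `q` are mutually recursive. -/
def MutuallyRecursive (P : Set (Clause L V)) (p q : Σ n, L.Relations n) : Prop :=
  DependsOn P p q ∧ DependsOn P q p

/-! ### LD-derivations -/

/-- One resolution step: the program clause that is used, the variant of it that serves as the
input clause, and the most general unifier. -/
structure Step (L : FirstOrder.Language.{u, v}) (V : Type w) where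
  clause : Clause L V
  input : Clause L V
  mgu : Subst L V

/-- The variables used so far in a derivation with start query `Q₀` and steps `ξ`. -/
def usedVars (Q₀ : Query L V) (ξ : List (Step L V)) : Set V :=
  Query.vars Q₀ ∪ {x | ∃ s ∈ ξ, x ∈ s.input.vars ∪ s.mgu.vars}

/-- `LDDerivation P Q₀ ξ Q`: the steps `ξ` (in this order) form a finite LD-derivation for `P`
from `Q₀` to `Q`. At every step the leftmost atom is selected, and the input clause is a variant of
a clause of `P` without variables in common with the start query, the earlier input clauses and the
earlier unifiers (standardization apart). -/
inductive LDDerivation (P : Set (Clause L V)) (Q₀ : Query L V) :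
    List (Step L V) → Query L V → Prop
  | nil : LDDerivation P Q₀ [] Q₀
  | step {ξ : List (Step L V)} {A : Atom L V} {Q : Query L V} (s : Step L V) :
      LDDerivation P Q₀ ξ (A :: Q) →
      s.clause ∈ P →
      s.input.Variant s.clause →
      Disjoint s.input.vars (usedVars Q₀ ξ) →
      IsMGU s.mgu A s.input.head →
      LDDerivation P Q₀ (ξ ++ [s]) (Query.subst (s.input.body ++ Q) s.mgu)

/-- `σ` is a computed answer substitution for `P` and `Q`: the composition of the unifiers of a
successful LD-derivation (one that ends in the empty query), restricted to the variables of `Q`. -/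
def ComputedAnswer (P : Set (Clause L V)) (Q : Query L V) (σ : Subst L V) : Prop :=
  ∃ ξ : List (Step L V), LDDerivation P Q ξ [] ∧
    σ = Subst.restrict
      ((ξ.map Step.mgu).foldl Subst.comp (FirstOrder.Language.Term.var : Subst L V)) (Query.vars Q)

/-- The call set `Call(P, S)`: all atoms with a variant that is the selected (leftmost) atom in some
LD-derivation for `P` that starts from an atomic query in `S`. -/
def Call (P : Set (Clause L V)) (S : Set (Atom L V)) : Set (Atom L V) :=
  {A | ∃ Q₀ ∈ S, ∃ (ξ : List (Step L V)) (B : Atom L V) (Q : Query L V),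
    LDDerivation P [Q₀] ξ (B :: Q) ∧ A.Variant B}

/-! ### LD-trees and LD-termination -/

/-- `T` is an LD-tree for `P` and `Q₀`. A node is given by the path from the root to it, which is an
LD-derivation; a node has exactly one child for every clause of `P` that is applicable at it, and no
other children. -/
structure IsLDTree (P : Set (Clause L V)) (Q₀ : Query L V) (T : Set (List (Step L V))) : Prop where
  root : [] ∈ T
  derivation : ∀ ξ ∈ T, ∃ Q, LDDerivation P Q₀ ξ Q
  parent : ∀ ξ s, ξ ++ [s] ∈ T → ξ ∈ T
  child : ∀ ξ ∈ T, ∀ c ∈ P, (∃ s : Step L V, s.clause = c ∧ ∃ Q, LDDerivation P Q₀ (ξ ++ [s]) Q) →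
    ∃! s : Step L V, s.clause = c ∧ ξ ++ [s] ∈ T

/-- The nodes of an LD-tree that is built with a fixed choice of input clauses and unifiers. -/
inductive ChosenNode (P : Set (Clause L V)) (Q₀ : Query L V) : List (Step L V) → Prop
  | nil : ChosenNode P Q₀ []
  | step {ξ : List (Step L V)} (c : Clause L V) (hξ : ChosenNode P Q₀ ξ)
      (h : ∃ s : Step L V, s.clause = c ∧ ∃ Q, LDDerivation P Q₀ (ξ ++ [s]) Q) :
      ChosenNode P Q₀ (ξ ++ [h.choose])

/-- An LD-tree always exists. -/
theorem exists_isLDTree (P : Set (Clause L V)) (Q₀ : Query L V) : ∃ T, IsLDTree P Q₀ T := by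
  have key : ∀ ζ, ChosenNode P Q₀ ζ → ∀ ξ s, ζ = ξ ++ [s] → ChosenNode P Q₀ ξ ∧
      ∃ (c : Clause L V) (h : ∃ s : Step L V, s.clause = c ∧ ∃ Q, LDDerivation P Q₀ (ξ ++ [s]) Q),
        s = h.choose := by
    intro ζ hζ ξ s e
    cases hζ with
    | nil => simp at e
    | step c hξ h =>
      obtain ⟨rfl, e2⟩ := List.append_inj' e rfl
      simp only [List.cons.injEq, and_true] at e2
      exact ⟨hξ, c, h, e2.symm⟩
  refine ⟨{ξ | ChosenNode P Q₀ ξ}, ChosenNode.nil, ?_, fun ξ s h => (key _ h ξ s rfl).1, ?_⟩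
  · intro ξ hξ
    cases hξ with
    | nil => exact ⟨_, LDDerivation.nil⟩
    | step c hξ h => exact h.choose_spec.2
  · intro ξ hξ c _ h
    refine ⟨h.choose, ⟨h.choose_spec.1, ChosenNode.step c hξ h⟩, ?_⟩
    rintro s ⟨hs, hm⟩
    obtain ⟨_, c', h', rfl⟩ := key _ hm ξ s rfl
    have e : c' = c := h'.choose_spec.1.symm.trans hs
    subst e
    rfl

/-- `Q` LD-terminates for `P`: the LD-tree is finite. The LD-tree depends on the choice of the
names of variables and of the unifiers; the finiteness is required for all choices. -/
def LDTerminates (P : Set (Clause L V)) (Q : Query L V) : Prop :=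
  ∀ T, IsLDTree P Q T → T.Finite

/-! ### Term-acceptability -/

/-- `gt` is a well-founded order: an irreflexive, asymmetric and transitive relation without
infinite descending sequences. -/
structure IsWellFoundedOrder {X : Type*} (gt : X → X → Prop) : Prop where
  irrefl : ∀ x, ¬ gt x x
  asymm : ∀ x y, gt x y → ¬ gt y x
  trans : ∀ x y z, gt x y → gt y z → gt x z
  no_descending : ¬ ∃ f : ℕ → X, ∀ n, gt (f n) (f (n + 1))

/-- `P` is term-acceptable with respect to `S`. The clause is renamed apart from the call `A`,
and the names of the new variables in the computed answer `σ` for `(B₁, …, Bᵢ₋₁)θ` do not clash with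
those of the variables of `Bᵢθ` (standardization apart). Here `i` counts from `0`. -/
def TermAcceptable (P : Set (Clause L V)) (S : Set (Atom L V)) : Prop :=
  ∃ gt : ExtHerbrandBase L V → ExtHerbrandBase L V → Prop,
    IsWellFoundedOrder gt ∧
    ∀ A ∈ Call P S, ∀ c ∈ P, ∀ c' : Clause L V, c'.Variant c → Disjoint c'.vars A.vars →
      ∀ θ : Subst L V, IsMGU θ A c'.head →
      ∀ (i : ℕ) (hi : i < c'.body.length), MutuallyRecursive P (c'.body[i]).rel A.rel →
      ∀ σ : Subst L V, ComputedAnswer P (Query.subst (c'.body.take i) θ) σ →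
      (∀ x ∈ Query.vars (Query.subst (c'.body.take i) θ), ∀ y ∈ termVars (σ x),
        y ∈ ((c'.body[i]).subst θ).vars → y ∈ Query.vars (Query.subst (c'.body.take i) θ)) →
      gt A.toBase (((c'.body[i]).subst θ).subst σ).toBase

end LogicProgram

/-!
The proof separates the combinatorics of resolution from the names of variables. The relation `Run`
resolves the leftmost atom of a query with arbitrary instances of program clauses; it needs neither
unifiers nor renamings. An LD-derivation from `Q₀` represents exactly the runs from the instances
of `Q₀` that use the same clauses: `LDDerivation.run` (soundness) and `LDDerivation.exists_factor`
(completeness, by the universal property of most general unifiers). Conversely, each such run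
gives rise to an LD-derivation whose new variables avoid a given finite set
(`exists_derivation_of_run`); this needs the unification theorem `exists_relevant_mgu`. Since the
program is finite, an LD-tree is finite if and only if its depth is bounded, that is, if and only if
the runs from the instances of its root have bounded length (`ldTerminates_iff_not_unbounded`).

If all queries in `S` terminate, the order is "`B` is reached by a nonempty run from the call `A`".
Runs can be concatenated, so the order is transitive, and the first `n` members of a descending
sequence yield a run of at least `n` steps from an instance of a query in `S`; hence there is no
infinite descending sequence.

Conversely, let a call `A` have unbounded runs. By the pigeonhole principle some resolvent of `A` is
unbounded. In its shortest unbounded prefix `X, C` the part `X` is bounded, so a single list of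
clauses erases instances of `X` before arbitrarily long runs from `C`; the corresponding computed
answer `σ` makes `Cσ` unbounded (`Unbounded.exists_directCall`), and `Cσ` is again a call
(`DirectCall.mem_call`). Iteration gives an infinite sequence of calls. Its predicates are among the
finitely many heads of the program, so from some point on they are mutually recursive, and
term-acceptability turns the sequence into an infinite descending one.
-/

namespace LogicProgram

open FirstOrder.Language (Term)

variable {L : FirstOrder.Language.{u, v}} {V : Type w}

/-! ### Variables and substitutions -/

@[simp]
theorem termVars_var (x : V) : termVars (Term.var x : L.Term V) = {x} := by
  ext y; simp [termVars, Term.varFinset]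

@[simp]
theorem termVars_func {n : ℕ} (f : L.Functions n) (ts : Fin n → L.Term V) :
    termVars (Term.func f ts) = ⋃ i, termVars (ts i) := by
  ext y; simp [termVars, Term.varFinset]

theorem termVars_finite (t : L.Term V) : (termVars t).Finite := by
  classical exact Finset.finite_toSet _

theorem term_subst_congr {t : L.Term V} {θ η : Subst L V} (h : ∀ x ∈ termVars t, θ x = η x) :
    t.subst θ = t.subst η := by
  induction t with
  | var x => exact h x (by simp)
  | func f ts ih =>
    simp only [Term.subst]
    congr 1; funext i
    exact ih i fun x hx => h x (by simpa using ⟨i, hx⟩)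

theorem mem_termVars_subst {t : L.Term V} {θ : Subst L V} {y : V} :
    y ∈ termVars (t.subst θ) ↔ ∃ x ∈ termVars t, y ∈ termVars (θ x) := by
  induction t with
  | var x => simp [Term.subst]
  | func f ts ih => simp [Term.subst, ih]; tauto

theorem Subst.comp_assoc (θ η ζ : Subst L V) : (θ.comp η).comp ζ = θ.comp (η.comp ζ) := by
  funext x; simp [Subst.comp, term_subst_subst]

theorem Subst.vars_subset_iff {θ : Subst L V} {U : Set V} :
    θ.vars ⊆ U ↔ (∀ x ∉ U, θ x = Term.var x) ∧ ∀ x ∈ U, termVars (θ x) ⊆ U := by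
  constructor
  · intro h
    refine ⟨fun x hx => by_contra fun hne => hx (h (Or.inl hne)), fun x hx y hy => ?_⟩
    by_cases hd : θ x = Term.var x
    · rw [hd] at hy
      simpa [Set.mem_singleton_iff.1 (termVars_var (L := L) x ▸ hy)] using hx
    · exact h (Or.inr ⟨x, hd, hy⟩)
  · rintro ⟨h1, h2⟩ x (hx | ⟨y, hy, hxy⟩)
    · exact by_contra fun hU => hx (h1 x hU)
    · exact h2 y (by_contra fun hU => hy (h1 y hU)) hxy

theorem Subst.vars_finite {θ : Subst L V} (h : θ.dom.Finite) : θ.vars.Finite := by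
  refine h.union ((h.biUnion fun x _ => termVars_finite (θ x)).subset ?_)
  rintro y ⟨x, hx, hy⟩
  exact Set.mem_biUnion hx hy

theorem termVars_subst_subset (t : L.Term V) (θ : Subst L V) :
    termVars (t.subst θ) ⊆ termVars t ∪ θ.vars := by
  intro y hy
  obtain ⟨x, hx, hxy⟩ := mem_termVars_subst.1 hy
  by_cases hd : θ x = Term.var x
  · rw [hd, termVars_var] at hxy
    exact Or.inl (hxy ▸ hx)
  · exact Or.inr (Or.inr ⟨x, hd, hxy⟩)

theorem Atom.vars_finite (A : Atom L V) : A.vars.Finite := by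
  refine (Set.finite_iUnion fun i => termVars_finite (A.args i)).subset ?_
  rintro x ⟨i, hi⟩
  exact Set.mem_iUnion.2 ⟨i, hi⟩

theorem Query.vars_finite (Q : Query L V) : (Query.vars Q).Finite := by
  refine ((List.finite_toSet Q).biUnion fun A _ => A.vars_finite).subset ?_
  rintro x ⟨A, hA, hx⟩
  exact Set.mem_biUnion hA hx

theorem Clause.vars_finite (c : Clause L V) : c.vars.Finite :=
  c.head.vars_finite.union (Query.vars_finite _)

theorem Atom.subst_congr {A : Atom L V} {θ η : Subst L V} (h : ∀ x ∈ A.vars, θ x = η x) :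
    A.subst θ = A.subst η := by
  unfold Atom.subst
  congr 1; funext i
  exact term_subst_congr fun x hx => h x ⟨i, hx⟩

@[simp]
theorem Query.subst_cons (A : Atom L V) (Q : Query L V) (θ : Subst L V) :
    Query.subst (A :: Q) θ = A.subst θ :: Query.subst Q θ := rfl

@[simp]
theorem Query.subst_append (Q R : Query L V) (θ : Subst L V) :
    Query.subst (Q ++ R) θ = Query.subst Q θ ++ Query.subst R θ := List.map_append

theorem Query.subst_subst (Q : Query L V) (θ η : Subst L V) :
    Query.subst (Query.subst Q θ) η = Query.subst Q (θ.comp η) := by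
  simp [Query.subst, Function.comp_def, Atom.subst_subst]

theorem Query.subst_var (Q : Query L V) : Query.subst Q Term.var = Q := by
  simp [Query.subst, Atom.subst_var]

theorem Query.subst_congr {Q : Query L V} {θ η : Subst L V}
    (h : ∀ x ∈ Query.vars Q, θ x = η x) : Query.subst Q θ = Query.subst Q η :=
  List.map_congr_left fun A hA => Atom.subst_congr fun x hx => h x ⟨A, hA, hx⟩

theorem Clause.subst_congr {c : Clause L V} {θ η : Subst L V} (h : ∀ x ∈ c.vars, θ x = η x) :
    c.subst θ = c.subst η := by
  unfold Clause.subst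
  rw [Atom.subst_congr fun x hx => h x (Or.inl hx), Query.subst_congr fun x hx => h x (Or.inr hx)]

theorem Clause.subst_subst (c : Clause L V) (θ η : Subst L V) :
    (c.subst θ).subst η = c.subst (θ.comp η) := by
  simp [Clause.subst, Atom.subst_subst, Query.subst_subst]

theorem Clause.subst_var (c : Clause L V) : c.subst Term.var = c := by
  simp [Clause.subst, Atom.subst_var, Query.subst_var]

theorem Atom.mem_vars_subst {A : Atom L V} {θ : Subst L V} {y : V} :
    y ∈ (A.subst θ).vars ↔ ∃ x ∈ A.vars, y ∈ termVars (θ x) := by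
  constructor
  · rintro ⟨i, hi⟩
    obtain ⟨x, hx, hy⟩ := mem_termVars_subst.1 hi
    exact ⟨x, ⟨i, hx⟩, hy⟩
  · rintro ⟨x, ⟨i, hx⟩, hy⟩
    exact ⟨i, mem_termVars_subst.2 ⟨x, hx, hy⟩⟩

theorem Query.mem_vars_subst {Q : Query L V} {θ : Subst L V} {y : V} :
    y ∈ Query.vars (Query.subst Q θ) ↔ ∃ x ∈ Query.vars Q, y ∈ termVars (θ x) := by
  constructor
  · rintro ⟨B, hB, hy⟩
    obtain ⟨A, hA, rfl⟩ := List.mem_map.1 hB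
    obtain ⟨x, hx, hy⟩ := Atom.mem_vars_subst.1 hy
    exact ⟨x, ⟨A, hA, hx⟩, hy⟩
  · rintro ⟨x, ⟨A, hA, hx⟩, hy⟩
    exact ⟨_, List.mem_map_of_mem hA, Atom.mem_vars_subst.2 ⟨x, hx, hy⟩⟩

theorem Query.vars_subst_subset (Q : Query L V) (θ : Subst L V) :
    Query.vars (Query.subst Q θ) ⊆ Query.vars Q ∪ θ.vars := by
  intro y hy
  obtain ⟨x, hx, hxy⟩ := Query.mem_vars_subst.1 hy
  by_cases hd : θ x = Term.var x
  · rw [hd, termVars_var] at hxy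
    exact Or.inl (hxy ▸ hx)
  · exact Or.inr (Or.inr ⟨x, hd, hxy⟩)

@[simp]
theorem Query.vars_append (Q R : Query L V) :
    Query.vars (Q ++ R) = Query.vars Q ∪ Query.vars R := by
  ext x; simp [Query.vars, or_and_right, exists_or]

@[simp]
theorem Query.vars_cons (A : Atom L V) (Q : Query L V) :
    Query.vars (A :: Q) = A.vars ∪ Query.vars Q := by
  ext x; simp [Query.vars]

theorem Clause.exists_fresh_variant [Infinite V] (c : Clause L V) {W : Set V} (hW : W.Finite) :
    ∃ c' : Clause L V, c'.Variant c ∧ Disjoint c'.vars W := by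
  have hcard : Cardinal.mk (Wᶜ : Set V) = Cardinal.mk V :=
    Cardinal.mk_compl_of_infinite W
      (lt_of_lt_of_le hW.lt_aleph0 (Cardinal.aleph0_le_mk V))
  -- Rename all variables injectively into the complement of `W`.
  obtain ⟨e⟩ := Cardinal.eq.1 hcard.symm
  classical
  let ρ : Subst L V := fun x => Term.var (e x : V)
  let ρ' : Subst L V := fun y => if h : y ∈ Wᶜ then Term.var (e.symm ⟨y, h⟩) else Term.var y
  have hρ : ρ.comp ρ' = Term.var := by
    funext x
    have : (e x : V) ∉ W := (e x).2
    simp [ρ, ρ', Subst.comp, Term.subst, this]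
  refine ⟨c.subst ρ, ⟨⟨ρ', by rw [Clause.subst_subst, hρ, Clause.subst_var]⟩, ρ, rfl⟩, ?_⟩
  rw [Set.disjoint_left]
  have key : ∀ x y : V, y ∈ termVars (ρ x) → y ∉ W := by
    intro x y hy
    have : y = (e x : V) := by simpa [ρ] using hy
    exact this ▸ (e x).2
  rintro y (hy | hy)
  · obtain ⟨x, -, hx⟩ := Atom.mem_vars_subst.1 hy
    exact key x y hx
  · obtain ⟨x, -, hx⟩ := Query.mem_vars_subst.1 hy
    exact key x y hx

/-! ### Existence of relevant most general unifiers -/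

/-- The number of symbols of a term. -/
def termSize : L.Term V → ℕ
  | .var _ => 1
  | .func _ ts => 1 + ∑ i, termSize (ts i)

theorem termSize_pos (t : L.Term V) : 0 < termSize t := by
  cases t <;> simp [termSize]

theorem termSize_le_of_mem_termVars {t : L.Term V} {x : V} (h : x ∈ termVars t)
    (η : Subst L V) : termSize (η x) ≤ termSize (t.subst η) := by
  induction t with
  | var y => simp at h; subst h; rfl
  | func f ts ih =>
    obtain ⟨i, hi⟩ : ∃ i, x ∈ termVars (ts i) := by simpa using h
    have := Finset.single_le_sum (f := fun i => termSize ((ts i).subst η))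
      (fun _ _ => Nat.zero_le _) (Finset.mem_univ i)
    simp only [Term.subst, termSize]
    have := ih i hi
    omega

/-- `η` solves the system `E` of equations between terms. -/
def Solves (η : Subst L V) (E : List (L.Term V × L.Term V)) : Prop :=
  ∀ p ∈ E, p.1.subst η = p.2.subst η

/-- The total size of the solved left-hand sides of a system of equations. -/
def solvedSize (η : Subst L V) (E : List (L.Term V × L.Term V)) : ℕ :=
  (E.map fun p => termSize (p.1.subst η)).sum

/-- The system `E` has a most general solution that lives on the variables in `U`. Being most
general is stated in the strong form `η = θη`, which also makes `θ` idempotent. -/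
def HasRelevantMGU (U : Set V) (E : List (L.Term V × L.Term V)) : Prop :=
  ∃ θ : Subst L V, θ.vars ⊆ U ∧ Solves θ E ∧ ∀ η : Subst L V, Solves η E → η = θ.comp η

open Classical in
/-- Elimination of a variable: an equation `x = t` may be removed from a system by replacing `x`
by `t` everywhere else. -/
theorem HasRelevantMGU.elim {U : Set V} {E : List (L.Term V × L.Term V)} {x : V} {t : L.Term V}
    (hx : x ∉ termVars t) (hxU : x ∈ U) (ht : termVars t ⊆ U)
    (h : HasRelevantMGU U (E.map fun p =>
      (p.1.subst (Function.update Term.var x t), p.2.subst (Function.update Term.var x t)))) :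
    HasRelevantMGU U ((Term.var x, t) :: E) := by
  set δ : Subst L V := Function.update Term.var x t with hδ
  have hδt : t.subst δ = t := by
    conv_rhs => rw [← term_subst_var t]
    refine term_subst_congr fun y hy => ?_
    rw [hδ, Function.update_of_ne]
    rintro rfl; exact hx hy
  obtain ⟨θ, hθU, hθ, hm⟩ := h
  rw [Subst.vars_subset_iff] at hθU
  refine ⟨δ.comp θ, Subst.vars_subset_iff.2 ⟨fun y hy => ?_, fun y hy => ?_⟩, ?_, ?_⟩
  · have hne : y ≠ x := by rintro rfl; exact hy hxU
    simp [Subst.comp, hδ, Function.update_of_ne hne, Term.subst, hθU.1 y hy]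
  · have hsub : termVars (δ y) ⊆ U := by
      by_cases e : y = x
      · subst e; simpa [hδ] using ht
      · simpa [hδ, Function.update_of_ne e] using hy
    intro z hz
    obtain ⟨a, ha, hz⟩ := mem_termVars_subst.1 hz
    exact hθU.2 a (hsub ha) hz
  · intro p hp
    rcases List.mem_cons.1 hp with rfl | hp
    · simp only [← term_subst_subst]
      rw [hδt]
      simp [Term.subst, hδ]
    · simp only [← term_subst_subst]
      exact hθ _ (List.mem_map_of_mem hp)
  · intro η hη
    have h1 : δ.comp η = η := by
      funext y
      by_cases e : y = x
      · subst e
        simpa [Subst.comp, hδ, Term.subst] using (hη _ List.mem_cons_self).symm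
      · simp [Subst.comp, hδ, Function.update_of_ne e, Term.subst]
    have h2 := hm η (by
      intro p hp
      obtain ⟨q, hq, rfl⟩ := List.mem_map.1 hp
      simp only [term_subst_subst, h1]
      exact hη q (List.mem_cons_of_mem _ hq))
    rw [Subst.comp_assoc, ← h2, h1]

open Classical in
/-- A solution is also a solution, of the same size, of the system after the elimination of a
variable. -/
theorem solves_elim {η : Subst L V} {E : List (L.Term V × L.Term V)} {x : V} {t : L.Term V}
    (h : η x = t.subst η) (hη : Solves η E) :
    Solves η (E.map fun p =>
      (p.1.subst (Function.update Term.var x t), p.2.subst (Function.update Term.var x t))) ∧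
    solvedSize η (E.map fun p =>
      (p.1.subst (Function.update Term.var x t), p.2.subst (Function.update Term.var x t))) =
      solvedSize η E := by
  have h1 : Subst.comp (Function.update Term.var x t) η = η := by
    funext y
    by_cases e : y = x
    · subst e; simpa [Subst.comp] using h.symm
    · simp [Subst.comp, Function.update_of_ne e, Term.subst]
  refine ⟨fun p hp => ?_, ?_⟩
  · obtain ⟨q, hq, rfl⟩ := List.mem_map.1 hp
    simp only [term_subst_subst, h1]
    exact hη q hq
  · simp [solvedSize, Function.comp_def, term_subst_subst, h1]

/-- Unification theorem. A solution `η` controls the termination of the unification algorithm: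
every step of it decreases the total size of the equations after the application of `η`. -/
theorem hasRelevantMGU_of_solves {U : Set V} (η : Subst L V) (E : List (L.Term V × L.Term V))
    (hE : ∀ p ∈ E, termVars p.1 ⊆ U ∧ termVars p.2 ⊆ U) (hη : Solves η E) :
    HasRelevantMGU U E := by
  classical
  induction hn : solvedSize η E using Nat.strong_induction_on generalizing E with
  | _ n ih =>
  subst hn
  match E with
  | [] =>
    exact ⟨Term.var, Subst.vars_subset_iff.2 ⟨fun _ _ => rfl, fun x hx => by simpa using hx⟩,
      by simp [Solves], fun _ _ => rfl⟩
  | (s, t) :: E =>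
    have hst : s.subst η = t.subst η := hη _ List.mem_cons_self
    have hη' : Solves η E := fun p hp => hη p (List.mem_cons_of_mem _ hp)
    have hsU : termVars s ⊆ U := (hE _ List.mem_cons_self).1
    have htU : termVars t ⊆ U := (hE _ List.mem_cons_self).2
    have hE' : ∀ p ∈ E, termVars p.1 ⊆ U ∧ termVars p.2 ⊆ U :=
      fun p hp => hE p (List.mem_cons_of_mem _ hp)
    have hlt : solvedSize η E < solvedSize η ((s, t) :: E) := by
      have := termSize_pos (s.subst η)
      simp [solvedSize, this]
    -- the case of an equation between a variable and a term that does not contain it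
    have elim : ∀ (x : V) (r : L.Term V), x ∉ termVars r → x ∈ U → termVars r ⊆ U →
        η x = r.subst η → HasRelevantMGU U ((Term.var x, r) :: E) := by
      intro x r hx hxU hr hxr
      obtain ⟨h1, h2⟩ := solves_elim hxr hη'
      refine HasRelevantMGU.elim hx hxU hr (ih _ (h2 ▸ hlt) _ ?_ h1 rfl)
      intro p hp
      obtain ⟨q, hq, rfl⟩ := List.mem_map.1 hp
      have hδ : ∀ y ∈ U, termVars (Function.update (Term.var : V → L.Term V) x r y) ⊆ U := by
        intro y hy
        by_cases e : y = x
        · subst e; simpa using hr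
        · simpa [Function.update_of_ne e] using hy
      constructor
      · intro z hz
        obtain ⟨a, ha, hz⟩ := mem_termVars_subst.1 hz
        exact hδ a ((hE' q hq).1 ha) hz
      · intro z hz
        obtain ⟨a, ha, hz⟩ := mem_termVars_subst.1 hz
        exact hδ a ((hE' q hq).2 ha) hz
    -- the occurs check
    have occurs : ∀ (x : V) {n : ℕ} (f : L.Functions n) (ts : Fin n → L.Term V),
        η x = (Term.func f ts).subst η → x ∉ termVars (Term.func f ts) := by
      intro x n f ts e hx
      obtain ⟨i, hi⟩ : ∃ i, x ∈ termVars (ts i) := by simpa using hx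
      have h1 := termSize_le_of_mem_termVars hi η
      have h2 := Finset.single_le_sum (f := fun i => termSize ((ts i).subst η))
        (fun _ _ => Nat.zero_le _) (Finset.mem_univ i)
      rw [e] at h1
      simp only [Term.subst, termSize] at h1 h2
      omega
    match s, t with
    | .var x, .var y =>
      by_cases e : x = y
      · subst e
        obtain ⟨θ, h1, h2, h3⟩ := ih _ hlt E hE' hη' rfl
        refine ⟨θ, h1, ?_, fun ζ hζ => h3 ζ fun p hp => hζ p (List.mem_cons_of_mem _ hp)⟩
        intro p hp
        rcases List.mem_cons.1 hp with rfl | hp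
        · rfl
        · exact h2 p hp
      · exact elim x _ (by simpa using e) (hsU (by simp)) htU hst
    | .var x, .func f ts =>
      exact elim x _ (occurs x f ts hst) (hsU (by simp)) htU hst
    | .func f ts, .var x =>
      have hs : ∀ ζ : Subst L V, Solves ζ ((Term.var x, Term.func f ts) :: E) ↔
          Solves ζ ((Term.func f ts, Term.var x) :: E) := by
        intro ζ; simp [Solves, eq_comm]
      obtain ⟨θ, h1, h2, h3⟩ :=
        elim x _ (occurs x f ts hst.symm) (htU (by simp)) hsU hst.symm
      exact ⟨θ, h1, (hs θ).1 h2, fun ζ hζ => h3 ζ ((hs ζ).2 hζ)⟩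
    | .func (l := n) f ts, .func (l := m) g rs =>
      simp only [Term.subst] at hst
      obtain ⟨rfl, hfg, hargs⟩ := Term.func.inj hst
      obtain rfl := eq_of_heq hfg
      have hargs' : ∀ i, (ts i).subst η = (rs i).subst η := congrFun (eq_of_heq hargs)
      have hs : ∀ ζ : Subst L V, Solves ζ (List.ofFn (fun i => (ts i, rs i)) ++ E) ↔
          Solves ζ ((Term.func f ts, Term.func f rs) :: E) := by
        intro ζ
        simp [Solves, or_imp, forall_and, Term.subst, funext_iff]
      obtain ⟨θ, h1, h2, h3⟩ := ih (solvedSize η (List.ofFn (fun i => (ts i, rs i)) ++ E))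
        (by
          simp [solvedSize, List.map_ofFn, List.sum_ofFn, Term.subst, termSize, Function.comp_def])
        (List.ofFn (fun i => (ts i, rs i)) ++ E)
        (by
          intro p hp
          rcases List.mem_append.1 hp with hp | hp
          · obtain ⟨i, rfl⟩ := List.mem_ofFn.1 hp
            rw [termVars_func] at hsU htU
            exact ⟨(Set.subset_iUnion _ i).trans hsU, (Set.subset_iUnion _ i).trans htU⟩
          · exact hE' p hp)
        ((hs η).2 hη) rfl
      exact ⟨θ, h1, (hs θ).1 h2, fun ζ hζ => h3 ζ ((hs ζ).2 hζ)⟩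

theorem exists_relevant_mgu {A B : Atom L V} {η : Subst L V} (h : A.subst η = B.subst η) :
    ∃ θ, IsMGU θ A B ∧ θ.vars ⊆ A.vars ∪ B.vars := by
  obtain ⟨n, p, ts⟩ := A
  obtain ⟨m, q, rs⟩ := B
  simp only [Atom.subst, Atom.mk.injEq] at h
  obtain ⟨rfl, hpq, hargs⟩ := h
  obtain rfl := eq_of_heq hpq
  have hs : ∀ ζ : Subst L V, Solves ζ (List.ofFn (fun i => (ts i, rs i))) ↔
      Atom.subst ⟨n, p, ts⟩ ζ = Atom.subst ⟨n, p, rs⟩ ζ := by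
    intro ζ
    simp [Solves, Atom.subst, funext_iff]
  obtain ⟨θ, h1, h2, h3⟩ := hasRelevantMGU_of_solves
    (U := Atom.vars ⟨n, p, ts⟩ ∪ Atom.vars ⟨n, p, rs⟩) η (List.ofFn (fun i => (ts i, rs i)))
    (by
      intro e he
      obtain ⟨i, rfl⟩ := List.mem_ofFn.1 he
      exact ⟨fun x hx => Or.inl ⟨i, hx⟩, fun x hx => Or.inr ⟨i, hx⟩⟩)
    ((hs η).2 (by simpa [Atom.subst] using hargs))
  refine ⟨θ, ⟨?_, (hs θ).1 h2, fun ζ hζ => ⟨ζ, h3 ζ ((hs ζ).2 hζ)⟩⟩, h1⟩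
  exact ((Atom.vars_finite _).union (Atom.vars_finite _)).subset (Set.subset_union_left.trans h1)

/-! ### Resolution with clause instances -/

/-- `Run X cs Y`: the query `X` is rewritten to `Y` by replacing, for every clause of the list `cs`
in turn, the leftmost atom, which has to be an instance of the head of the clause, by the
corresponding instance of the body. No unification takes place: the query itself is never
instantiated, and the variables have no meaning. -/
inductive Run : Query L V → List (Clause L V) → Query L V → Prop
  | nil (X : Query L V) : Run X [] X
  | cons (c : Clause L V) (η : Subst L V) {cs : List (Clause L V)} {T Y : Query L V} :
      Run (Query.subst c.body η ++ T) cs Y → Run (c.head.subst η :: T) (c :: cs) Y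

theorem Run.nil_iff {X Y : Query L V} : Run X [] Y ↔ X = Y :=
  ⟨fun h => by cases h; rfl, fun h => h ▸ Run.nil X⟩

theorem Run.cons_inv {c : Clause L V} {cs : List (Clause L V)} {X Y : Query L V}
    (h : Run X (c :: cs) Y) :
    ∃ η T, X = c.head.subst η :: T ∧ Run (Query.subst c.body η ++ T) cs Y := by
  cases h with
  | cons c η h => exact ⟨η, _, rfl, h⟩

theorem Run.append {X Y Z : Query L V} {cs ds : List (Clause L V)} (h : Run X cs Y)
    (h' : Run Y ds Z) : Run X (cs ++ ds) Z := by
  induction h with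
  | nil => exact h'
  | cons c η _ ih => exact Run.cons c η (ih h')

theorem Run.append_inv {cs ds : List (Clause L V)} {X Z : Query L V} (h : Run X (cs ++ ds) Z) :
    ∃ Y, Run X cs Y ∧ Run Y ds Z := by
  induction cs generalizing X with
  | nil => exact ⟨X, Run.nil X, h⟩
  | cons c cs ih =>
    obtain ⟨η, T, rfl, hr⟩ := h.cons_inv
    obtain ⟨Y, h1, h2⟩ := ih hr
    exact ⟨Y, Run.cons c η h1, h2⟩

theorem Run.append_right {X Y : Query L V} {cs : List (Clause L V)} (h : Run X cs Y)
    (R : Query L V) : Run (X ++ R) cs (Y ++ R) := by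
  induction h with
  | nil => exact Run.nil _
  | cons c η _ ih =>
    rw [List.append_assoc] at ih
    exact Run.cons c η ih

/-- Resolution of `X ++ Y` either stays within `X` or first erases `X`. -/
theorem Run.split {X Y Z : Query L V} {cs : List (Clause L V)} (h : Run (X ++ Y) cs Z) :
    (∃ X', Run X cs X' ∧ Z = X' ++ Y) ∨
      ∃ cs₁ cs₂, cs = cs₁ ++ cs₂ ∧ Run X cs₁ [] ∧ Run Y cs₂ Z := by
  induction cs generalizing X with
  | nil => exact Or.inl ⟨X, Run.nil X, (Run.nil_iff.1 h).symm⟩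
  | cons c cs ih =>
    cases X with
    | nil => exact Or.inr ⟨[], c :: cs, rfl, Run.nil _, h⟩
    | cons A X =>
      obtain ⟨η, T, e, hr⟩ := h.cons_inv
      obtain ⟨rfl, rfl⟩ : A = c.head.subst η ∧ X ++ Y = T := List.cons.inj e
      rw [← List.append_assoc] at hr
      rcases ih hr with ⟨X', h1, h2⟩ | ⟨cs₁, cs₂, rfl, h1, h2⟩
      · exact Or.inl ⟨X', Run.cons c η h1, h2⟩
      · exact Or.inr ⟨c :: cs₁, cs₂, rfl, Run.cons c η h1, h2⟩

theorem Run.length_eq {X Y X' Y' : Query L V} {cs : List (Clause L V)} (h : Run X cs Y)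
    (h' : Run X' cs Y') (hl : X.length = X'.length) : Y.length = Y'.length := by
  induction h generalizing X' with
  | nil => rwa [← Run.nil_iff.1 h']
  | cons c η _ ih =>
    obtain ⟨η', T', rfl, hr⟩ := h'.cons_inv
    refine ih hr ?_
    simpa [Query.subst] using hl

/-- The clauses alone determine how many atoms a query has after resolution: if they erase `X`, they
erase every query of the same length. -/
theorem Run.erase_of_length_eq {X X' Y Z : Query L V} {cs : List (Clause L V)} (h : Run X cs [])
    (h' : Run (X' ++ Y) cs Z) (hl : X.length = X'.length) : Run X' cs [] ∧ Z = Y := by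
  rcases h'.split with ⟨X'', h1, rfl⟩ | ⟨cs₁, cs₂, rfl, h1, h2⟩
  · have := h.length_eq h1 hl
    obtain rfl : X'' = [] := List.length_eq_zero_iff.1 this.symm
    exact ⟨h1, rfl⟩
  · obtain ⟨X₁, h3, h4⟩ := h.append_inv
    obtain rfl : X₁ = [] := List.length_eq_zero_iff.1 (h3.length_eq h1 hl)
    obtain rfl : cs₂ = [] := by
      cases cs₂ with
      | nil => rfl
      | cons c cs => obtain ⟨_, _, e, _⟩ := h4.cons_inv; cases e
    exact ⟨by simpa using h1, (Run.nil_iff.1 h2).symm⟩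

/-! ### Soundness and completeness of LD-derivations -/

/-- The composition of the unifiers of a sequence of steps. -/
def composedMGU (ξ : List (Step L V)) : Subst L V :=
  (ξ.map Step.mgu).foldl Subst.comp Term.var

@[simp]
theorem composedMGU_concat (ξ : List (Step L V)) (s : Step L V) :
    composedMGU (ξ ++ [s]) = (composedMGU ξ).comp s.mgu := by
  simp [composedMGU]

theorem usedVars_concat (Q₀ : Query L V) (ξ : List (Step L V)) (s : Step L V) :
    usedVars Q₀ (ξ ++ [s]) = usedVars Q₀ ξ ∪ (s.input.vars ∪ s.mgu.vars) := by
  ext x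
  simp only [usedVars, List.mem_append, List.mem_singleton, Set.mem_union, Set.mem_ofPred_eq,
    or_and_right, exists_or, exists_eq_left, or_assoc]

theorem queryVars_subset_usedVars (Q₀ : Query L V) (ξ : List (Step L V)) :
    Query.vars Q₀ ⊆ usedVars Q₀ ξ := Set.subset_union_left

theorem LDDerivation.concat_inv {P : Set (Clause L V)} {Q₀ Q' : Query L V} {ξ : List (Step L V)}
    {s : Step L V} (h : LDDerivation P Q₀ (ξ ++ [s]) Q') :
    ∃ A Q, LDDerivation P Q₀ ξ (A :: Q) ∧ s.clause ∈ P ∧ s.input.Variant s.clause ∧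
      Disjoint s.input.vars (usedVars Q₀ ξ) ∧ IsMGU s.mgu A s.input.head ∧
      Q' = Query.subst (s.input.body ++ Q) s.mgu := by
  generalize e : ξ ++ [s] = ζ at h
  cases h with
  | nil => simp at e
  | step s' h h1 h2 h3 h4 =>
    obtain ⟨rfl, e2⟩ := List.append_inj' e rfl
    cases e2
    exact ⟨_, _, h, h1, h2, h3, h4, rfl⟩

theorem LDDerivation.clause_mem {P : Set (Clause L V)} {Q₀ Q : Query L V} {ξ : List (Step L V)}
    (h : LDDerivation P Q₀ ξ Q) : ∀ c ∈ ξ.map Step.clause, c ∈ P := by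
  induction h with
  | nil => simp
  | step s _ h1 _ _ _ ih =>
    intro c hc
    rw [List.map_append, List.mem_append] at hc
    rcases hc with hc | hc
    · exact ih c hc
    · simp only [List.map_cons, List.map_nil, List.mem_singleton] at hc
      exact hc ▸ h1

theorem LDDerivation.usedVars_finite {P : Set (Clause L V)} {Q₀ Q : Query L V}
    {ξ : List (Step L V)} (h : LDDerivation P Q₀ ξ Q) : (usedVars Q₀ ξ).Finite := by
  induction h with
  | nil => simpa [usedVars] using Query.vars_finite Q₀
  | step s _ _ _ _ h4 ih =>
    rw [usedVars_concat]
    exact ih.union (s.input.vars_finite.union (Subst.vars_finite h4.1))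

theorem LDDerivation.vars_subset {P : Set (Clause L V)} {Q₀ Q : Query L V} {ξ : List (Step L V)}
    (h : LDDerivation P Q₀ ξ Q) : Query.vars Q ⊆ usedVars Q₀ ξ := by
  induction h with
  | nil => exact queryVars_subset_usedVars _ _
  | step s _ _ _ _ _ ih =>
    rw [usedVars_concat]
    intro x hx
    rw [Query.vars_cons] at ih
    rcases Query.vars_subst_subset _ _ hx with hx | hx
    · rw [Query.vars_append] at hx
      rcases hx with hx | hx
      · exact Or.inr (Or.inl (Or.inr hx))
      · exact Or.inl (ih (Or.inr hx))
    · exact Or.inr (Or.inr hx)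

theorem LDDerivation.termVars_composedMGU_subset {P : Set (Clause L V)} {Q₀ Q : Query L V}
    {ξ : List (Step L V)} (h : LDDerivation P Q₀ ξ Q) {x : V} (hx : x ∈ Query.vars Q₀) :
    termVars (composedMGU ξ x) ⊆ usedVars Q₀ ξ := by
  induction h with
  | nil => simpa [composedMGU] using queryVars_subset_usedVars Q₀ [] hx
  | step s _ _ _ _ _ ih =>
    rw [usedVars_concat, composedMGU_concat]
    intro y hy
    rcases termVars_subst_subset _ _ hy with hy | hy
    · exact Or.inl (ih hy)
    · exact Or.inr (Or.inr hy)

/-- If the atom `Aγ` is an instance of the head of `c`, then `A` unifies with the head of a variant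
of `c` that is renamed apart. -/
theorem exists_unifier {c c' : Clause L V} (hc : c'.Variant c) {X : Set V}
    (hX : Disjoint c'.vars X) {A : Atom L V} (hA : A.vars ⊆ X) {γ η : Subst L V}
    (h : A.subst γ = c.head.subst η) :
    ∃ ζ : Subst L V, (∀ x ∈ X, ζ x = γ x) ∧ c'.subst ζ = c.subst η ∧
      A.subst ζ = c'.head.subst ζ := by
  classical
  obtain ⟨⟨σ, hσ⟩, -⟩ := hc
  -- As `c'` is renamed apart, the two instantiations can be merged into one substitution.
  let ζ : Subst L V := fun x => if x ∈ c'.vars then (σ x).subst η else γ x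
  have h1 : ∀ x ∈ X, ζ x = γ x := fun x hx => if_neg fun h' => Set.disjoint_left.1 hX h' hx
  have h2 : c'.subst ζ = c.subst η := by
    rw [hσ, Clause.subst_subst]
    exact Clause.subst_congr fun x hx => if_pos hx
  refine ⟨ζ, h1, h2, ?_⟩
  rw [Atom.subst_congr fun x hx => h1 x (hA hx), h]
  exact (congrArg Clause.head h2).symm

/-- The resolvent is the most general one: every way of resolving an instance of the atom `A` with
an instance of the clause `c` is an instance of the resolution of `A` with a variant of `c`. -/
theorem exists_factor {c c' : Clause L V} (hc : c'.Variant c) {X : Set V}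
    (hX : Disjoint c'.vars X) {A : Atom L V} (hA : A.vars ⊆ X) {θ : Subst L V}
    (hθ : IsMGU θ A c'.head) {γ η : Subst L V} (h : A.subst γ = c.head.subst η) :
    ∃ γ' : Subst L V, (∀ x ∈ X, γ x = (θ x).subst γ') ∧
      Query.subst c.body η = Query.subst (Query.subst c'.body θ) γ' := by
  obtain ⟨ζ, h1, h2, h3⟩ := exists_unifier hc hX hA h
  obtain ⟨γ', rfl⟩ := hθ.2.2 ζ h3
  refine ⟨γ', fun x hx => (h1 x hx).symm, ?_⟩
  rw [Query.subst_subst]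
  exact (congrArg Clause.body h2).symm

/-- One resolution step with a most general unifier is a resolution step on all instances. -/
theorem run_resolvent {c c' : Clause L V} (hc : c'.Variant c) {A : Atom L V} {θ : Subst L V}
    (hθ : IsMGU θ A c'.head) (γ : Subst L V) {T Y : Query L V} {cs : List (Clause L V)}
    (h : Run (Query.subst (Query.subst c'.body θ) γ ++ T) cs Y) :
    Run ((A.subst θ).subst γ :: T) (c :: cs) Y := by
  obtain ⟨-, τ, rfl⟩ := hc
  rw [hθ.2.1, Clause.subst, Atom.subst_subst, Atom.subst_subst]
  refine Run.cons c _ ?_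
  rwa [Clause.subst, Query.subst_subst, Query.subst_subst] at h

/-- Soundness: an LD-derivation is a resolution of the instances of its start query that the
composed unifiers produce. -/
theorem LDDerivation.run {P : Set (Clause L V)} {Q₀ Q : Query L V} {ξ : List (Step L V)}
    (h : LDDerivation P Q₀ ξ Q) (γ : Subst L V) :
    Run (Query.subst (Query.subst Q₀ (composedMGU ξ)) γ) (ξ.map Step.clause)
      (Query.subst Q γ) := by
  induction h generalizing γ with
  | nil =>
    rw [show composedMGU ([] : List (Step L V)) = Term.var from rfl, Query.subst_var]
    exact Run.nil _
  | step s _ _ h2 _ h4 ih =>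
    rw [List.map_append, composedMGU_concat]
    have h := ih (s.mgu.comp γ)
    rw [Query.subst_subst, ← Subst.comp_assoc, ← Query.subst_subst] at h
    refine h.append ?_
    rw [Query.subst_cons, ← Atom.subst_subst]
    refine run_resolvent h2 h4 γ ?_
    rw [Query.subst_append, Query.subst_append, Query.subst_subst _ s.mgu γ,
      Query.subst_subst _ s.mgu γ]
    exact Run.nil _

/-- Completeness: an LD-derivation represents every resolution of instances of its start query that
uses the same clauses. -/
theorem LDDerivation.exists_factor {P : Set (Clause L V)} {Q₀ Q Y : Query L V}
    {ξ : List (Step L V)} (h : LDDerivation P Q₀ ξ Q) {η : Subst L V}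
    (hr : Run (Query.subst Q₀ η) (ξ.map Step.clause) Y) :
    ∃ γ : Subst L V, (∀ x ∈ Query.vars Q₀, η x = (composedMGU ξ x).subst γ) ∧
      Y = Query.subst Q γ := by
  induction h generalizing Y with
  | nil => exact ⟨η, fun _ _ => rfl, (Run.nil_iff.1 hr).symm⟩
  | step s h _ h2 h3 h4 ih =>
    rw [List.map_append] at hr
    obtain ⟨Y₁, hr1, hr2⟩ := hr.append_inv
    obtain ⟨γ, hγ, rfl⟩ := ih hr1
    obtain ⟨η', T, e, hr3⟩ := hr2.cons_inv
    obtain ⟨e1, rfl⟩ := List.cons.inj e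
    have hsub := h.vars_subset
    rw [Query.vars_cons, Set.union_subset_iff] at hsub
    obtain ⟨γ', h5, h6⟩ := LogicProgram.exists_factor h2 h3 hsub.1 h4 e1
    refine ⟨γ', fun x hx => ?_, ?_⟩
    · rw [hγ x hx, composedMGU_concat, Subst.comp, term_subst_subst]
      exact term_subst_congr fun y hy => h5 y (h.termVars_composedMGU_subset hx hy)
    · rw [← Run.nil_iff.1 hr3, h6, Query.subst_append, Query.subst_append,
        Query.subst_subst _ s.mgu]
      congr 1
      rw [Query.subst_subst]
      exact Query.subst_congr fun y hy => h5 y (hsub.2 hy)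

theorem LDDerivation.exists_step [Infinite V] {P : Set (Clause L V)} {Q₀ Q Y : Query L V}
    {ξ : List (Step L V)} (h : LDDerivation P Q₀ ξ Q) {c : Clause L V} (hc : c ∈ P)
    {γ : Subst L V} (hr : Run (Query.subst Q γ) [c] Y) {W : Set V} (hW : W.Finite) :
    ∃ s : Step L V, s.clause = c ∧ (∃ Q', LDDerivation P Q₀ (ξ ++ [s]) Q') ∧
      Disjoint s.input.vars W ∧ s.mgu.vars ⊆ Query.vars Q ∪ s.input.vars := by
  obtain ⟨η, T, e, -⟩ := hr.cons_inv
  cases Q with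
  | nil => cases e
  | cons A Q =>
    obtain ⟨e1, -⟩ := List.cons.inj e
    obtain ⟨c', hv, hd⟩ := c.exists_fresh_variant (h.usedVars_finite.union hW)
    rw [Set.disjoint_union_right] at hd
    have hsub := h.vars_subset
    rw [Query.vars_cons, Set.union_subset_iff] at hsub
    obtain ⟨ζ, -, -, hζ⟩ := exists_unifier hv hd.1 hsub.1 e1
    obtain ⟨θ, hθ, hrel⟩ := exists_relevant_mgu hζ
    refine ⟨⟨c, c', θ⟩, rfl, ⟨_, LDDerivation.step ⟨c, c', θ⟩ h hc hv hd.1 hθ⟩, hd.2, ?_⟩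
    rw [Query.vars_cons]
    exact hrel.trans (Set.union_subset_union Set.subset_union_left Set.subset_union_left)

/-- Every resolution of an instance of `Q₀` is represented by an LD-derivation whose new variables
avoid a given finite set. -/
theorem exists_derivation_of_run [Infinite V] {P : Set (Clause L V)} {Q₀ Y : Query L V}
    {η : Subst L V} {cs : List (Clause L V)} (hcs : ∀ c ∈ cs, c ∈ P)
    (hr : Run (Query.subst Q₀ η) cs Y) {W : Set V} (hW : W.Finite) :
    ∃ ξ Q, LDDerivation P Q₀ ξ Q ∧ ξ.map Step.clause = cs ∧
      ∀ x ∈ usedVars Q₀ ξ, x ∈ W → x ∈ Query.vars Q₀ := by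
  induction cs using List.reverseRecOn generalizing Y with
  | nil => exact ⟨[], Q₀, LDDerivation.nil, rfl, fun x hx _ => by simpa [usedVars] using hx⟩
  | append_singleton cs c ih =>
    obtain ⟨Y₁, hr1, hr2⟩ := hr.append_inv
    obtain ⟨ξ, Q, h, rfl, hξ⟩ := ih (fun c hc => hcs c (List.mem_append_left _ hc)) hr1
    obtain ⟨γ, -, rfl⟩ := h.exists_factor hr1
    obtain ⟨s, rfl, ⟨Q', h'⟩, hd, hrel⟩ := h.exists_step (hcs c (by simp)) hr2 hW
    refine ⟨_, Q', h', by simp, fun x hx hxW => ?_⟩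
    rw [usedVars_concat] at hx
    rcases hx with hx | hx | hx
    · exact hξ x hx hxW
    · exact absurd hxW (Set.disjoint_left.1 hd hx)
    · rcases hrel hx with hx | hx
      · exact hξ x (h.vars_subset hx) hxW
      · exact absurd hxW (Set.disjoint_left.1 hd hx)

/-! ### LD-trees -/

/-- An LD-tree represents every resolution of instances of its root. -/
theorem IsLDTree.exists_of_run [Infinite V] {P : Set (Clause L V)} {Q₀ Y : Query L V}
    {T : Set (List (Step L V))} (hT : IsLDTree P Q₀ T)
    {η : Subst L V} {cs : List (Clause L V)} (hcs : ∀ c ∈ cs, c ∈ P)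
    (hr : Run (Query.subst Q₀ η) cs Y) : ∃ ξ ∈ T, ξ.map Step.clause = cs := by
  induction cs using List.reverseRecOn generalizing Y with
  | nil => exact ⟨[], hT.root, rfl⟩
  | append_singleton cs c ih =>
    obtain ⟨Y₁, hr1, hr2⟩ := hr.append_inv
    obtain ⟨ξ, hξT, rfl⟩ := ih (fun c hc => hcs c (List.mem_append_left _ hc)) hr1
    obtain ⟨Q, h⟩ := hT.derivation ξ hξT
    obtain ⟨γ, -, rfl⟩ := h.exists_factor hr1
    have hc : c ∈ P := hcs c (by simp)
    obtain ⟨s, hs, hQ', -⟩ := h.exists_step hc hr2 Set.finite_empty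
    obtain ⟨s', ⟨rfl, hs'⟩, -⟩ := hT.child ξ hξT c hc ⟨s, hs, hQ'⟩
    exact ⟨_, hs', by simp⟩

/-- A node of an LD-tree is determined by the clauses used on the path to it, because a node has
only one child per clause. -/
theorem IsLDTree.injOn_clauses {P : Set (Clause L V)} {Q₀ : Query L V}
    {T : Set (List (Step L V))} (hT : IsLDTree P Q₀ T) :
    Set.InjOn (List.map Step.clause) T := by
  intro ξ hξ ζ hζ e
  induction ξ using List.reverseRecOn generalizing ζ with
  | nil => exact (List.map_eq_nil_iff.1 e.symm).symm
  | append_singleton ξ s ih =>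
    induction ζ using List.reverseRecOn with
    | nil => simp at e
    | append_singleton ζ t _ =>
      rw [List.map_append, List.map_append] at e
      obtain ⟨e1, e2⟩ := List.append_inj' e rfl
      obtain rfl := ih (hT.parent _ _ hξ) (hT.parent _ _ hζ) e1
      have hst : s.clause = t.clause := by simpa using e2
      obtain ⟨Q, hQ⟩ := hT.derivation _ hξ
      obtain ⟨A, R, -, hc, -⟩ := hQ.concat_inv
      have := (hT.child ξ (hT.parent _ _ hξ) _ hc ⟨s, rfl, Q, hQ⟩).unique
        ⟨rfl, hξ⟩ ⟨hst.symm, hζ⟩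
      rw [this]

theorem finite_lists_of_length_le {α : Type*} {F : Set α} (hF : F.Finite) (n : ℕ) :
    {l : List α | (∀ a ∈ l, a ∈ F) ∧ l.length ≤ n}.Finite := by
  have := hF.to_subtype
  refine ((List.finite_length_le F n).image (List.map Subtype.val)).subset ?_
  rintro l ⟨h1, h2⟩
  lift l to List F using h1
  exact ⟨l, by simpa using h2, rfl⟩

/-- `Q` is unbounded: the instances of `Q` can be resolved in arbitrarily many steps. -/
def Unbounded (P : Set (Clause L V)) (Q : Query L V) : Prop :=
  ∀ n : ℕ, ∃ (η : Subst L V) (cs : List (Clause L V)) (Y : Query L V),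
    (∀ c ∈ cs, c ∈ P) ∧ n ≤ cs.length ∧ Run (Query.subst Q η) cs Y

/-- By the finiteness of the program, LD-trees are infinite exactly when they have nodes of
arbitrary depth. -/
theorem ldTerminates_iff_not_unbounded [Infinite V] {P : Set (Clause L V)} (hP : P.Finite)
    (Q : Query L V) : LDTerminates P Q ↔ ¬ Unbounded P Q := by
  constructor
  · intro h hu
    obtain ⟨T, hT⟩ := exists_isLDTree P Q
    obtain ⟨N, hN⟩ := ((h T hT).image List.length).bddAbove
    obtain ⟨η, cs, Y, hcs, hn, hr⟩ := hu (N + 1)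
    obtain ⟨ξ, hξ, rfl⟩ := hT.exists_of_run hcs hr
    have := hN (Set.mem_image_of_mem _ hξ)
    rw [List.length_map] at hn
    omega
  · intro h T hT
    obtain ⟨N, hN⟩ := not_forall.1 h
    refine Set.Finite.of_finite_image ((finite_lists_of_length_le hP N).subset ?_)
      hT.injOn_clauses
    rintro _ ⟨ξ, hξ, rfl⟩
    obtain ⟨R, hR⟩ := hT.derivation ξ hξ
    refine ⟨hR.clause_mem, le_of_not_gt fun hlt => hN ?_⟩
    have hr := hR.run Term.var
    rw [Query.subst_var] at hr
    exact ⟨_, _, _, hR.clause_mem, hlt.le, hr⟩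

/-! ### Computed answers -/

theorem composedMGU_restrict_congr (ξ : List (Step L V)) (Q : Query L V) :
    Query.subst Q ((composedMGU ξ).restrict (Query.vars Q)) = Query.subst Q (composedMGU ξ) :=
  Query.subst_congr fun _ hx => if_pos hx

/-- The computed answer of a successful LD-derivation is most general among the substitutions
`η` for which `Qη` is erased by the same clauses. If the new variables of the answer avoid `W`, then
`η` is an instance of it on `W`, too. -/
theorem LDDerivation.exists_factor_answer {P : Set (Clause L V)} {Q : Query L V}
    {ξ : List (Step L V)} (h : LDDerivation P Q ξ []) {σ : Subst L V}
    (hσ : σ = (composedMGU ξ).restrict (Query.vars Q)) {W : Set V}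
    (hW : ∀ x ∈ Query.vars Q, ∀ y ∈ termVars (σ x), y ∈ W → y ∈ Query.vars Q) {η : Subst L V}
    (hr : Run (Query.subst Q η) (ξ.map Step.clause) []) :
    ∃ γ : Subst L V, ∀ x ∈ Query.vars Q ∪ W, η x = (σ x).subst γ := by
  classical
  obtain ⟨γ, hγ, -⟩ := h.exists_factor hr
  have hσ1 : ∀ x ∈ Query.vars Q, σ x = composedMGU ξ x := fun x hx => by
    rw [hσ]; exact if_pos hx
  have hσ2 : ∀ x ∉ Query.vars Q, σ x = Term.var x := fun x hx => by
    rw [hσ]; exact if_neg hx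
  -- `σ` does not move the variables in `W` outside `Q`, nor does it introduce them in `Q`, so
  -- `γ` may be redefined there.
  refine ⟨fun x => if x ∈ W \ Query.vars Q then η x else γ x, fun x hx => ?_⟩
  by_cases hxQ : x ∈ Query.vars Q
  · rw [hγ x hxQ, ← hσ1 x hxQ]
    refine term_subst_congr fun y hy => (if_neg ?_).symm
    exact fun hyW => hyW.2 (hW x hxQ y hy hyW.1)
  · rw [hσ2 x hxQ]
    exact (if_pos ⟨hx.resolve_left hxQ, hxQ⟩).symm

/-! ### Direct calls -/

/-- `B` is a direct call of `A`: it is the instance `Bᵢθσ` of a body atom of a variant of a clause,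
where `θ` is a most general unifier of `A` and the head, and `σ` is a computed answer, standardized
apart, for the body atoms before `Bᵢ`. -/
def DirectCall (P : Set (Clause L V)) (A B : Atom L V) : Prop :=
  ∃ c ∈ P, ∃ c' : Clause L V, c'.Variant c ∧ Disjoint c'.vars A.vars ∧
    ∃ θ : Subst L V, IsMGU θ A c'.head ∧ ∃ (i : ℕ) (hi : i < c'.body.length) (σ : Subst L V),
      ComputedAnswer P (Query.subst (c'.body.take i) θ) σ ∧
      (∀ x ∈ Query.vars (Query.subst (c'.body.take i) θ), ∀ y ∈ termVars (σ x),
        y ∈ ((c'.body[i]).subst θ).vars → y ∈ Query.vars (Query.subst (c'.body.take i) θ)) ∧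
      B = ((c'.body[i]).subst θ).subst σ

theorem termAcceptable_iff {P : Set (Clause L V)} {S : Set (Atom L V)} :
    TermAcceptable P S ↔ ∃ gt : ExtHerbrandBase L V → ExtHerbrandBase L V → Prop,
      IsWellFoundedOrder gt ∧ ∀ A ∈ Call P S, ∀ B, DirectCall P A B →
        MutuallyRecursive P B.rel A.rel → gt A.toBase B.toBase := by
  refine exists_congr fun gt => and_congr_right fun _ => ⟨fun h A hA B hB hm => ?_, ?_⟩
  · obtain ⟨c, hc, c', hv, hd, θ, hθ, i, hi, σ, hσ, hs, rfl⟩ := hB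
    exact h A hA c hc c' hv hd θ hθ i hi hm σ hσ hs
  · intro h A hA c hc c' hv hd θ hθ i hi hm σ hσ hs
    exact h A hA _ ⟨c, hc, c', hv, hd, θ, hθ, i, hi, σ, hσ, hs, rfl⟩ hm

theorem Clause.subst_body_eq (c : Clause L V) (θ : Subst L V) {i : ℕ} (hi : i < c.body.length) :
    Query.subst c.body θ = Query.subst (c.body.take i) θ ++ (c.body[i]).subst θ ::
      Query.subst (c.body.drop (i + 1)) θ := by
  rw [← Query.subst_cons, ← Query.subst_append, List.cons_getElem_drop_succ, List.take_append_drop]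

theorem DirectCall.refersTo {P : Set (Clause L V)} {A B : Atom L V} (h : DirectCall P A B) :
    RefersTo P A.rel B.rel := by
  obtain ⟨c, hc, c', ⟨-, τ, rfl⟩, -, θ, hθ, i, hi, σ, -, -, rfl⟩ := h
  refine ⟨c, hc, ?_, ?_⟩
  · exact (congrArg Atom.rel hθ.2.1).symm
  · obtain ⟨C, hC, e⟩ := List.mem_map.1 (List.getElem_mem hi)
    exact ⟨C, hC, by rw [← e]; rfl⟩

/-- `B` is reached from `A`: every instance of `B` becomes the leftmost atom in a nonempty
resolution of an instance of `A`. -/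
def Reaches (P : Set (Clause L V)) (A B : Atom L V) : Prop :=
  ∀ η : Subst L V, ∃ (ζ : Subst L V) (cs : List (Clause L V)) (R : Query L V),
    (∀ c ∈ cs, c ∈ P) ∧ cs ≠ [] ∧ Run [A.subst ζ] cs (B.subst η :: R)

theorem DirectCall.reaches {P : Set (Clause L V)} {A B : Atom L V} (h : DirectCall P A B) :
    Reaches P A B := by
  obtain ⟨c, hc, c', hv, -, θ, hθ, i, hi, σ, ⟨ξ, hξ, hσ⟩, -, rfl⟩ := h
  intro η
  have hr := hξ.run η
  rw [← composedMGU_restrict_congr, composedMGU, ← hσ] at hr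
  refine ⟨θ.comp (σ.comp η), c :: ξ.map Step.clause,
    Query.subst (Query.subst (c'.body.drop (i + 1)) θ) (σ.comp η), ?_, by simp, ?_⟩
  · simpa [hc] using hξ.clause_mem
  · rw [← Atom.subst_subst]
    refine run_resolvent hv hθ _ ?_
    rw [Clause.subst_body_eq c' θ hi, Query.subst_append, Query.subst_cons, List.append_nil,
      ← Query.subst_subst (Query.subst _ θ), ← Atom.subst_subst]
    exact hr.append_right _

theorem Reaches.trans {P : Set (Clause L V)} {A B C : Atom L V} (h : Reaches P A B)
    (h' : Reaches P B C) : Reaches P A C := by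
  intro η
  obtain ⟨ζ, cs, R, hcs, -, hr⟩ := h' η
  obtain ⟨ζ', cs', R', hcs', hne, hr'⟩ := h ζ
  refine ⟨ζ', cs' ++ cs, R ++ R', ?_, by simp [hne], hr'.append (hr.append_right R')⟩
  intro c hc
  exact (List.mem_append.1 hc).elim (hcs' c) (hcs c)

/-- The call set is closed under direct calls. -/
theorem DirectCall.mem_call [Infinite V] {P : Set (Clause L V)} {S : Set (Atom L V)}
    {A B : Atom L V} (h : DirectCall P A B) (hA : A ∈ Call P S) : B ∈ Call P S := by
  have ⟨c, hc, c', hv, hd, θ, hθ, i, hi, σ, ⟨ξ, hξ, hσ⟩, hs, hB⟩ := h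
  obtain ⟨Q₀, hQ₀, ξ₀, A₁, R, h₀, ⟨α, hα⟩, β, hβ⟩ := hA
  set X := Query.subst (c'.body.take i) θ with hX
  set C := (c'.body[i]).subst θ with hC
  -- A derivation from `Q₀` that uses the clauses which lead to `A`, then `c`, then those that erase
  -- the body atoms before `Bᵢ`.
  have hr₁ : Run (Query.subst (Query.subst X σ) Term.var) (ξ.map Step.clause) [] := by
    rw [hσ]
    have := hξ.run Term.var
    rwa [← composedMGU_restrict_congr] at this
  rw [Query.subst_var] at hr₁
  have hr₀ := h₀.run (β.comp (θ.comp σ))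
  rw [Query.subst_cons A₁, ← Atom.subst_subst A₁, ← hβ, ← Atom.subst_subst] at hr₀
  have hr₂ := hr₀.append (run_resolvent hv hθ σ (by
    rw [Clause.subst_body_eq c' θ hi, Query.subst_append, Query.subst_cons, List.append_assoc]
    exact hr₁.append_right _))
  rw [Query.subst_subst] at hr₂
  have hmem : ∀ d ∈ ξ₀.map Step.clause ++ c :: ξ.map Step.clause, d ∈ P := by
    intro d hd
    rcases List.mem_append.1 hd with hd | hd
    · exact h₀.clause_mem d hd
    · rcases List.mem_cons.1 hd with rfl | hd
      · exact hc
      · exact hξ.clause_mem d hd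
  obtain ⟨ξ', Q', h', hcl, -⟩ := exists_derivation_of_run hmem hr₂ Set.finite_empty
  rw [← hcl] at hr₂
  obtain ⟨γ', -, hQ'⟩ := h'.exists_factor hr₂
  -- The selected atom of its last query has `B` as an instance; it remains to show that it is
  -- itself an instance of `B`.
  cases Q' with
  | nil => cases hQ'
  | cons B' Q' =>
  obtain ⟨hB', -⟩ := List.cons.inj hQ'
  refine ⟨Q₀, hQ₀, ξ', B', Q', h', ?_, γ', hB.trans hB'⟩
  have hr₃ := h'.run Term.var
  rw [hcl, Query.subst_subst, Query.subst_var] at hr₃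
  obtain ⟨Y, hr₄, hr₅⟩ := hr₃.append_inv
  obtain ⟨γ₂, -, rfl⟩ := h₀.exists_factor hr₄
  obtain ⟨η', T, e, hr₆⟩ := hr₅.cons_inv
  obtain ⟨e1, rfl⟩ := List.cons.inj e
  change A₁.subst γ₂ = _ at e1
  rw [hα, Atom.subst_subst] at e1
  obtain ⟨γ₃, -, h₇⟩ := exists_factor hv hd subset_rfl hθ e1
  rw [h₇, Clause.subst_body_eq c' θ hi, Query.subst_append, Query.subst_cons,
    List.append_assoc] at hr₆
  obtain ⟨hr₇, e2⟩ := hr₁.erase_of_length_eq hr₆ (by simp [Query.subst, hX])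
  obtain ⟨γ₄, hγ₄⟩ := hξ.exists_factor_answer hσ hs hr₇
  refine ⟨γ₄, (List.cons.inj e2).1.trans ?_⟩
  rw [hB, Atom.subst_subst C]
  exact Atom.subst_congr (A := C) fun x hx => hγ₄ x (Or.inr hx)

/-! ### Unbounded calls -/

/-- Pigeonhole principle: if for every bound `n` some element of a finite set satisfies `p n`, then
one element satisfies `p n` for all `n`, provided that `p n` weakens as `n` decreases. -/
theorem exists_forall_of_forall_exists {α : Type*} {F : Set α} (hF : F.Finite)
    {p : ℕ → α → Prop} (hp : ∀ m n a, m ≤ n → p n a → p m a) (h : ∀ n, ∃ a ∈ F, p n a) :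
    ∃ a ∈ F, ∀ n, p n a := by
  by_contra! hne
  choose! N hN using hne
  obtain ⟨M, hM⟩ := (hF.image N).bddAbove
  obtain ⟨a, ha, hpa⟩ := h M
  exact hN a ha (hp _ _ a (hM (Set.mem_image_of_mem N ha)) hpa)

/-- If `A` is unbounded, then so is the resolvent of `A` with some clause. -/
theorem Unbounded.exists_resolvent [Infinite V] {P : Set (Clause L V)} (hP : P.Finite)
    {A : Atom L V} (h : Unbounded P [A]) :
    ∃ c ∈ P, ∃ c' : Clause L V, c'.Variant c ∧ Disjoint c'.vars A.vars ∧
      ∃ θ : Subst L V, IsMGU θ A c'.head ∧ Unbounded P (Query.subst c'.body θ) := by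
  obtain ⟨c, hc, H⟩ := exists_forall_of_forall_exists hP
    (p := fun n c => ∃ (γ η : Subst L V) (cs : List (Clause L V)) (Y : Query L V),
      A.subst γ = c.head.subst η ∧ (∀ d ∈ cs, d ∈ P) ∧ n ≤ cs.length ∧
        Run (Query.subst c.body η) cs Y)
    (by
      rintro m n c hmn ⟨γ, η, cs, Y, h1, h2, h3, h4⟩
      exact ⟨γ, η, cs, Y, h1, h2, hmn.trans h3, h4⟩)
    (by
      intro n
      obtain ⟨γ, cs, Y, hcs, hn, hr⟩ := h (n + 1)
      cases cs with
      | nil => simp at hn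
      | cons c cs =>
        obtain ⟨η, T, e, hr⟩ := hr.cons_inv
        obtain ⟨e1, rfl⟩ := List.cons.inj e
        refine ⟨c, hcs c (by simp), γ, η, cs, Y, e1,
          fun d hd => hcs d (List.mem_cons_of_mem _ hd), by simpa using hn, ?_⟩
        rwa [List.map_nil, List.append_nil] at hr)
  obtain ⟨c', hv, hd⟩ := c.exists_fresh_variant A.vars_finite
  obtain ⟨γ, η, -, -, e, -⟩ := H 0
  obtain ⟨ζ, -, -, hζ⟩ := exists_unifier hv hd subset_rfl e
  obtain ⟨θ, hθ, -⟩ := exists_relevant_mgu hζ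
  refine ⟨c, hc, c', hv, hd, θ, hθ, fun n => ?_⟩
  obtain ⟨γ, η, cs, Y, e, hcs, hn, hr⟩ := H n
  obtain ⟨γ', -, hγ'⟩ := exists_factor hv hd subset_rfl hθ e
  exact ⟨γ', cs, Y, hcs, hn, hγ' ▸ hr⟩

/-- If `X` is bounded, but `X, C` is not, then `Cσ` is unbounded for some computed answer `σ` of
`X`. -/
theorem Unbounded.exists_answer [Infinite V] {P : Set (Clause L V)} (hP : P.Finite)
    {X : Query L V} {C : Atom L V} (hX : ¬ Unbounded P X) (h : Unbounded P (X ++ [C])) :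
    ∃ σ : Subst L V, ComputedAnswer P X σ ∧
      (∀ x ∈ Query.vars X, ∀ y ∈ termVars (σ x), y ∈ C.vars → y ∈ Query.vars X) ∧
      Unbounded P [C.subst σ] := by
  obtain ⟨N, hN⟩ := not_forall.1 hX
  obtain ⟨cs, ⟨hcs, -⟩, H⟩ := exists_forall_of_forall_exists (finite_lists_of_length_le hP N)
    (p := fun n cs => ∃ (η : Subst L V) (ds : List (Clause L V)) (Y : Query L V),
      Run (Query.subst X η) cs [] ∧ (∀ d ∈ ds, d ∈ P) ∧ n ≤ ds.length ∧
        Run [C.subst η] ds Y)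
    (by
      rintro m n cs hmn ⟨η, ds, Y, h1, h2, h3, h4⟩
      exact ⟨η, ds, Y, h1, h2, hmn.trans h3, h4⟩)
    (by
      intro n
      obtain ⟨η, cs, Y, hcs, hn, hr⟩ := h (N + n)
      rw [Query.subst_append] at hr
      rcases hr.split with ⟨X', h1, -⟩ | ⟨cs₁, cs₂, rfl, h1, h2⟩
      · exact absurd ⟨η, cs, X', hcs, (Nat.le_add_right _ _).trans hn, h1⟩ hN
      · have hcs₁ : ∀ c ∈ cs₁, c ∈ P := fun c hc => hcs c (List.mem_append_left _ hc)
        have hlen : cs₁.length ≤ N :=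
          le_of_not_gt fun hlt => hN ⟨η, cs₁, [], hcs₁, hlt.le, h1⟩
        rw [List.length_append] at hn
        exact ⟨cs₁, ⟨hcs₁, hlen⟩, η, cs₂, Y, h1,
          fun c hc => hcs c (List.mem_append_right _ hc), by omega, h2⟩)
  obtain ⟨η, -, -, hr, -⟩ := H 0
  obtain ⟨ξ, Q, hξ, rfl, hW⟩ := exists_derivation_of_run hcs hr C.vars_finite
  obtain ⟨γ, -, hQ⟩ := hξ.exists_factor hr
  obtain rfl : Q = [] := List.map_eq_nil_iff.1 hQ.symm
  have hapart : ∀ x ∈ Query.vars X, ∀ y ∈ termVars ((composedMGU ξ).restrict (Query.vars X) x),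
      y ∈ C.vars → y ∈ Query.vars X := by
    intro x hx y hy hyC
    rw [show (composedMGU ξ).restrict (Query.vars X) x = composedMGU ξ x from if_pos hx] at hy
    exact hW y (hξ.termVars_composedMGU_subset hx hy) hyC
  refine ⟨_, ⟨ξ, hξ, rfl⟩, hapart, fun n => ?_⟩
  obtain ⟨η, ds, Y, hr, hds, hn, hr'⟩ := H n
  obtain ⟨γ, hγ⟩ := hξ.exists_factor_answer rfl hapart hr
  refine ⟨γ, ds, Y, hds, hn, ?_⟩
  rw [Atom.subst_congr fun x hx => hγ x (Or.inr hx)] at hr'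
  rw [Query.subst_cons, Atom.subst_subst]
  exact hr'

theorem not_unbounded_nil (P : Set (Clause L V)) : ¬ Unbounded P [] := by
  intro h
  obtain ⟨η, cs, Y, -, hn, hr⟩ := h 1
  cases cs with
  | nil => simp at hn
  | cons c cs => obtain ⟨_, _, e, -⟩ := hr.cons_inv; cases e

theorem Unbounded.exists_directCall [Infinite V] {P : Set (Clause L V)} (hP : P.Finite)
    {A : Atom L V} (h : Unbounded P [A]) : ∃ B, DirectCall P A B ∧ Unbounded P [B] := by
  classical
  obtain ⟨c, hc, c', hv, hd, θ, hθ, hu⟩ := h.exists_resolvent hP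
  -- The call is an instance of the last atom of the shortest unbounded prefix of the resolvent.
  have hex : ∃ i, Unbounded P (Query.subst (c'.body.take i) θ) :=
    ⟨c'.body.length, by rwa [List.take_length]⟩
  have hspec := Nat.find_spec hex
  have hmin := fun i => Nat.find_min hex (m := i)
  cases hk : Nat.find hex with
  | zero =>
    rw [hk] at hspec
    exact absurd hspec (not_unbounded_nil P)
  | succ i =>
    rw [hk] at hspec hmin
    have hi : i < c'.body.length := by
      by_contra hlt
      refine hmin i (Nat.lt_succ_self i) ?_
      rw [List.take_of_length_le (by omega)]
      exact hu
    rw [← List.take_concat_get' _ _ hi, Query.subst_append] at hspec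
    obtain ⟨σ, hσ, hs, hB⟩ := hspec.exists_answer hP (hmin i (Nat.lt_succ_self i))
    exact ⟨_, ⟨c, hc, c', hv, hd, θ, hθ, i, hi, σ, hσ, hs, rfl⟩, hB⟩

/-! ### The two implications -/

theorem mem_call_of_mem (P : Set (Clause L V)) {S : Set (Atom L V)} {A : Atom L V} (hA : A ∈ S) :
    A ∈ Call P S :=
  ⟨A, hA, [], A, [], LDDerivation.nil, ⟨_, A.subst_var.symm⟩, _, A.subst_var.symm⟩

theorem Reaches.congr {P : Set (Clause L V)} {A A' B B' : Atom L V} (hA : A.Variant A')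
    (hB : B.Variant B') (h : Reaches P A B) : Reaches P A' B' := by
  obtain ⟨-, α, rfl⟩ := hA
  obtain ⟨⟨β, rfl⟩, -⟩ := hB
  intro η
  obtain ⟨ζ, cs, R, hcs, hne, hr⟩ := h (β.comp η)
  refine ⟨α.comp ζ, cs, R, hcs, hne, ?_⟩
  rwa [Atom.subst_subst] at hr ⊢

theorem exists_call_run {P : Set (Clause L V)} {S : Set (Atom L V)} {A : Atom L V}
    (hA : A ∈ Call P S) : ∃ Q₀ ∈ S, ∀ η : Subst L V, ∃ (ζ : Subst L V) (cs : List (Clause L V))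
      (R : Query L V), (∀ c ∈ cs, c ∈ P) ∧ Run [Q₀.subst ζ] cs (A.subst η :: R) := by
  obtain ⟨Q₀, hQ₀, ξ, A₁, R, h, -, β, hβ⟩ := hA
  refine ⟨Q₀, hQ₀, fun η => ?_⟩
  have hr := h.run (β.comp η)
  rw [Query.subst_cons A₁, ← Atom.subst_subst A₁, ← hβ, Query.subst_subst] at hr
  exact ⟨_, _, _, h.clause_mem, hr⟩

/-- In an infinite path through a finite part of a relation, from some point on every element can be
reached from its successor. -/
theorem exists_forall_reflTransGen {α : Type*} {r : α → α → Prop} {F : Set α} (hF : F.Finite)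
    (f : ℕ → α) (hf : ∀ n, f n ∈ F) (hr : ∀ n, r (f n) (f (n + 1))) :
    ∃ k, ∀ n, k ≤ n → Relation.ReflTransGen r (f (n + 1)) (f n) := by
  have path : ∀ m n, m ≤ n → Relation.ReflTransGen r (f m) (f n) := by
    intro m n hmn
    induction n, hmn using Nat.le_induction with
    | base => exact .refl
    | succ n _ ih => exact ih.tail (hr n)
  obtain ⟨a, -, ha⟩ := exists_forall_of_forall_exists hF
    (p := fun n a => ∃ m, n ≤ m ∧ f m = a)
    (by rintro m n a hmn ⟨k, hk, e⟩; exact ⟨k, hmn.trans hk, e⟩)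
    (fun n => ⟨f n, hf n, n, le_rfl, rfl⟩)
  obtain ⟨k, -, rfl⟩ := ha 0
  refine ⟨k, fun n hn => ?_⟩
  obtain ⟨m, hm, e⟩ := ha (n + 1)
  exact (e ▸ path _ _ hm).trans (path _ _ hn)

/-- Termination implies term-acceptability, witnessed by the order `Reaches` on calls. -/
theorem termAcceptable_of_not_unbounded {P : Set (Clause L V)} {S : Set (Atom L V)}
    (h : ∀ A ∈ S, ¬ Unbounded P [A]) : TermAcceptable P S := by
  rw [termAcceptable_iff]
  let gt : ExtHerbrandBase L V → ExtHerbrandBase L V → Prop := fun a b =>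
    ∃ A B, A.toBase = a ∧ B.toBase = b ∧ A ∈ Call P S ∧ Reaches P A B
  have htrans : ∀ a b c, gt a b → gt b c → gt a c := by
    rintro _ _ _ ⟨A, B, rfl, rfl, hA, hAB⟩ ⟨B', C, e, rfl, -, hBC⟩
    have hv : B'.Variant B := Quotient.exact e
    exact ⟨A, C, rfl, rfl, hA,
      hAB.trans (hBC.congr hv ((variantSetoid L V).refl C))⟩
  have hdesc : ¬ ∃ f : ℕ → ExtHerbrandBase L V, ∀ n, gt (f n) (f (n + 1)) := by
    rintro ⟨f, hf⟩
    obtain ⟨A, -, hfA, -, hA, -⟩ := hf 0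
    obtain ⟨Q₀, hQ₀, hrun⟩ := exists_call_run hA
    -- The first `n` steps of the descending sequence give a resolution of at least `n` steps.
    have key : ∀ n, ∃ B : Atom L V, B.toBase = f n ∧ ∀ η : Subst L V, ∃ (ζ : Subst L V)
        (cs : List (Clause L V)) (R : Query L V),
        (∀ c ∈ cs, c ∈ P) ∧ n ≤ cs.length ∧ Run [Q₀.subst ζ] cs (B.subst η :: R) := by
      intro n
      induction n with
      | zero =>
        refine ⟨A, hfA, fun η => ?_⟩
        obtain ⟨ζ, cs, R, hcs, hr⟩ := hrun η
        exact ⟨ζ, cs, R, hcs, Nat.zero_le _, hr⟩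
      | succ n ih =>
        obtain ⟨B, hB, H⟩ := ih
        obtain ⟨B', C, hB', hC, -, hBC⟩ := hf n
        have hv : B'.Variant B := Quotient.exact (hB'.trans hB.symm)
        refine ⟨C, hC, fun η => ?_⟩
        obtain ⟨ζ, cs, R, hcs, hne, hr⟩ := hBC.congr hv ((variantSetoid L V).refl C) η
        obtain ⟨ζ', cs', R', hcs', hn, hr'⟩ := H ζ
        refine ⟨ζ', cs' ++ cs, R ++ R', ?_, ?_, hr'.append (hr.append_right R')⟩
        · exact fun c hc => (List.mem_append.1 hc).elim (hcs' c) (hcs c)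
        · have := List.length_pos_iff.2 hne
          rw [List.length_append]
          omega
    refine h Q₀ hQ₀ fun n => ?_
    obtain ⟨B, -, H⟩ := key n
    obtain ⟨ζ, cs, R, hcs, hn, hr⟩ := H Term.var
    exact ⟨ζ, cs, _, hcs, hn, hr⟩
  have hirrefl : ∀ a, ¬ gt a a := fun a ha => hdesc ⟨fun _ => a, fun _ => ha⟩
  exact ⟨gt, ⟨hirrefl, fun a b hab hba => hirrefl a (htrans _ _ _ hab hba), htrans, hdesc⟩,
    fun A hA B hAB _ => ⟨A, B, rfl, rfl, hA, hAB.reaches⟩⟩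

/-- An unbounded call would start an infinite sequence of direct calls, which eventually descends in
the order of term-acceptability. -/
theorem TermAcceptable.not_unbounded [Infinite V] {P : Set (Clause L V)} (hP : P.Finite)
    {S : Set (Atom L V)} (h : TermAcceptable P S) {A : Atom L V} (hA : A ∈ Call P S) :
    ¬ Unbounded P [A] := by
  intro hu
  obtain ⟨gt, hgt, hacc⟩ := termAcceptable_iff.1 h
  have hnext : ∀ A : {A // A ∈ Call P S ∧ Unbounded P [A]},
      ∃ B : {A // A ∈ Call P S ∧ Unbounded P [A]}, DirectCall P A.1 B.1 := by
    rintro ⟨A, hA, hu⟩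
    obtain ⟨B, hAB, hB⟩ := hu.exists_directCall hP
    exact ⟨⟨B, hAB.mem_call hA, hB⟩, hAB⟩
  choose next hnext using hnext
  let a : ℕ → {A // A ∈ Call P S ∧ Unbounded P [A]} := fun n => next^[n] ⟨A, hA, hu⟩
  have ha : ∀ n, DirectCall P (a n).1 (a (n + 1)).1 := by
    intro n
    simp only [a, Function.iterate_succ_apply']
    exact hnext _
  obtain ⟨k, hk⟩ := exists_forall_reflTransGen (r := RefersTo P)
    (hP.image fun c : Clause L V => c.head.rel) (fun n => (a n).1.rel)
    (fun n => by
      obtain ⟨c, hc, e, -⟩ := (ha n).refersTo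
      exact ⟨c, hc, e⟩)
    (fun n => (ha n).refersTo)
  refine hgt.no_descending ⟨fun n => (a (k + n)).1.toBase, fun n => ?_⟩
  exact hacc _ (a (k + n)).2.1 _ (ha (k + n))
    ⟨hk (k + n) (Nat.le_add_right _ _), Relation.ReflTransGen.single (ha (k + n)).refersTo⟩

end LogicProgram

theorem mainTheorem1 {L : FirstOrder.Language.{u, v}} {V : Type w} [Infinite V]
    (P : Set (LogicProgram.Clause L V)) (hP : P.Finite) (S : Set (LogicProgram.Atom L V)) :
    LogicProgram.TermAcceptable P S ↔ ∀ A ∈ S, LogicProgram.LDTerminates P [A] := by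
  simp only [LogicProgram.ldTerminates_iff_not_unbounded hP]
  exact ⟨fun h A hA => h.not_unbounded hP (LogicProgram.mem_call_of_mem P hA),
    LogicProgram.termAcceptable_of_not_unbounded⟩
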